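/- **Definitions.** A *diagram* is a pair $(N,B)$ with $N$ a finite set and $B=(B_{ij})_{i,j\in N}$ a symmetric integer matrix with even diagonal entries; it is a *graph* if all $B_{ij}\ge 0$ and all $B_{ii}=0$. *Stokes circles.* An exponential factor at infinity is a finite sum $q=\sum_k a_k z^k$ with $a_k\in\mathbb C$ and positive rational exponents $k$. A Stokes circle $I=\langle q\rangle$ is an orbit of exponential factors under $\sum_k a_kz^k\mapsto\sum_k e^{2\pi i nk}a_kz^k$, $n\in\mathbb Z$. Its set of exponents is $E(I)=\{k: a_k\ne 0\}$, its ramification order $\mathrm{Ram}(I)$ is the lcm of the denominators of its exponents ($1$ for $q=0$), and the slope of $q$ is its largest exponent ($0$ for $q=0$). Put $\tau_l(q)=\sum_{k\ge l}a_kz^k$ and $\tau_l\langle q\rangle=\langle\tau_l(q)\rangle$. *Multiplicities.* For positive integers $r,r'$ and a finite set $S=\{k_0>\dots>k_t\}$ of positive rationals with $k_j=m_j/r=m_j'/r'$ and $m_j,m'_j$ integers, put $$\Lambda_{r,r'}(S)=\sum_{j=0}^{t} m_j\bigl(\gcd(r',m_0',\dots,m_{j-1}')-\gcd(r',m'_0,\dots,m'_j)\bigr),$$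 where the first gcd is $r'$ for $j=0$. For a Stokes circle $I$ with $r=\mathrm{Ram}(I)$, set $B_{I,I}=\Lambda_{r,r}(E(I))-r^2+1$. For distinct Stokes circles $I=\langle q\rangle$ and $J=\langle q'\rangle$ with ramification orders $r,r'$, let $k$ be the least positive element of $\frac1{\mathrm{lcm}(r,r')}\mathbb Z$ with $\tau_k(I)=\tau_k(J)$; let $q_d=q-\tau_k(q)$ and $q'_d=q'-\tau_k(q')$, and let $S=\{k_0>\dots>k_t\}$ be the set of exponents of $\tau_k(I)=\tau_k(J)$. If the slope $f$ of $q_d$ is at least that of $q'_d$, write $f=s_d/r$ and set $$B_{I,J}=\Lambda_{r,r'}(S)+s_d\gcd(r',m'_0,\dots,m'_t)-rr';$$ otherwise exchange the roles of $I$ and $J$. *Nonabelian Hodge diagrams.* Let $(E,\nabla)$ be an algebraic connection on the affine line over $\mathbb C$ with coordinate $z$, that is, a finitely generated projective $\mathbb C[z]$-module $E$ with an additive map $\nabla:E\to E$ such that $\nabla(fv)=f'v+f\nabla v$. Its irregular class at infinity is the finite multiset $\Theta=\sum n_iI_i$ of distinct Stokes circles $I_i$ with $n_i\ge1$ such that in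 some basis of $E$ there is a formal fundamental matrix of horizontal sections $g\,z^{L}e^{\mathrm{diag}(q_1,\dots,q_n)}$, with $g$ invertible over $\mathbb C((z^{-1/R}))$ for some integer $R\ge1$, the $q_j$ exponential factors that are polynomials in $z^{1/R}$, and $L$ a constant matrix commuting with $\mathrm{diag}(q_1,\dots,q_n)$, where each exponential factor in the orbit $I_i$ occurs exactly $n_i$ times among $q_1,\dots,q_n$ and no other exponential factor occurs. A diagram $(N,B)$ is a *nonabelian Hodge diagram* if there are such an $(E,\nabla)$ with irregular class $\Theta$ and a bijection $i\mapsto I_i$ from $N$ to the set of distinct Stokes circles of $\Theta$ with $B_{ij}=B_{I_i,I_j}$ for all $i,j\in N$. A *nonabelian Hodge graph* is a nonabelian Hodge diagram that is a graph. *Rescaling.* For a diagram $(N,B)$ and integers $r_i\ge1$ ($i\in N$), put $\widetilde B_{ij}=\frac{B_{ij}}{r_ir_j}$ for $i\ne j$ and $\widetilde B_{ii}=\frac{B_{ii}-1}{r_i^2}$. The *rescaled ultrametric condition* for $r$ is: for all pairwise distinct $i,j,k\in N$, if $\widetilde B_{ij}\le\widetilde B_{ik}\le\widetilde B_{jk}$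 then $\widetilde B_{ik}=\widetilde B_{jk}$. **Proposition.** There exist graphs that are not nonabelian Hodge graphs, hence also diagrams that are not nonabelian Hodge diagrams. For example, the triangle with vertices $i,j,k$, edge multiplicities $B_{ij}=B_{ik}=0$, $B_{jk}=1$ and no loops is a graph that is not a nonabelian Hodge graph, and it does not satisfy the rescaled ultrametric condition for any integers $r_i,r_j,r_k\ge1$. -/

import Mathlib

open Polynomial
open scoped LaurentSeries

noncomputable section

namespace NAH

/-! ### Diagrams, graphs, decorations -/

/-- A diagram `(N, B)`: a finite set `N` (here `V`) and a symmetric integer matrix `B` whose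
diagonal entries are even. For `i ≠ j`, `B i j` is the (possibly negative) number of edges between
`i` and `j`, and `B i i / 2` is the (possibly negative) number of loops at `i`. -/
structure Diagram where
  V : Type
  [fintypeV : Fintype V]
  B : Matrix V V ℤ
  symm : ∀ i j, B i j = B j i
  even_diag : ∀ i, Even (B i i)

/-- A graph is a diagram without loops and without negative edges. -/
def Diagram.IsGraph (Γ : Diagram) : Prop :=
  (∀ i j, 0 ≤ Γ.B i j) ∧ ∀ i, Γ.B i i = 0

open Classical in
/-- The rescaled edge/loop multiplicities of a diagram with respect to a decoration `r`. -/
def Diagram.rescaled (Γ : Diagram) (r : Γ.V → ℕ) (i j : Γ.V) : ℚ :=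
  if i = j then ((Γ.B i i : ℚ) - 1) / (r i : ℚ) ^ 2
  else (Γ.B i j : ℚ) / ((r i : ℚ) * (r j : ℚ))

/-- The ultrametric condition for the rescaled edge multiplicities of the decorated diagram
`(Γ, r)`: in every triangle the two largest rescaled multiplicities are equal. -/
def Diagram.RescaledUltrametric (Γ : Diagram) (r : Γ.V → ℕ) : Prop :=
  ∀ i j k : Γ.V, i ≠ j → i ≠ k → j ≠ k →
    Γ.rescaled r i j ≤ Γ.rescaled r i k → Γ.rescaled r i k ≤ Γ.rescaled r j k →
    Γ.rescaled r i k = Γ.rescaled r j k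

/-- The triangle with edge multiplicities `0, 0, 1` (and no loops). -/
def triangle : Diagram where
  V := Fin 3
  B := !![0, 0, 0; 0, 0, 1; 0, 1, 0]
  symm := by intro i j; fin_cases i <;> fin_cases j <;> rfl
  even_diag := by intro i; fin_cases i <;> exact ⟨0, rfl⟩

/-! ### Exponential factors and Stokes circles at infinity -/

/-- Exponential factors at infinity: Puiseux polynomials `q = ∑ a_k z ^ k` with finitely many
terms, whose exponents `k` are positive rational numbers (`q k` is the coefficient of `z ^ k`). -/
def ExpFactor : Type := {q : ℚ →₀ ℂ // ∀ k ∈ q.support, 0 < k}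

/-- The coefficient of `z ^ k` after `n` turns around infinity gets multiplied by this number. -/
def turn (n : ℤ) (k : ℚ) : ℂ := Complex.exp (2 * Real.pi * Complex.I * (n : ℂ) * (k : ℂ))

lemma turn_zero (k : ℚ) : turn 0 k = 1 := by simp [turn]

lemma turn_add (m n : ℤ) (k : ℚ) : turn (m + n) k = turn m k * turn n k := by
  simp only [turn, ← Complex.exp_add]
  congr 1
  push_cast
  ring

lemma turn_ne_zero (n : ℤ) (k : ℚ) : turn n k ≠ 0 := Complex.exp_ne_zero _

/-- Two exponential factors are Galois conjugate if one is obtained from the other by analytic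
continuation around infinity, `z ^ k ↦ exp (2 π i n k) z ^ k`. -/
def galoisSetoid : Setoid ExpFactor where
  r q q' := ∃ n : ℤ, ∀ k : ℚ, q'.1 k = turn n k * q.1 k
  iseqv :=
    { refl := fun q => ⟨0, fun k => by simp [turn_zero]⟩
      symm := by
        rintro q q' ⟨n, h⟩
        refine ⟨-n, fun k => ?_⟩
        rw [h k, ← mul_assoc, ← turn_add]
        simp [turn_zero]
      trans := by
        rintro q q' q'' ⟨n, h⟩ ⟨m, h'⟩
        refine ⟨m + n, fun k => ?_⟩
        rw [h' k, h k, turn_add, mul_assoc] }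

/-- Stokes circles at infinity, i.e. Galois orbits of exponential factors. -/
def StokesCircle : Type := Quotient galoisSetoid

/-- The Stokes circle `⟨q⟩` of an exponential factor `q`. -/
def circ (q : ExpFactor) : StokesCircle := Quotient.mk galoisSetoid q

/-- The truncation `τ_l q`, which keeps the monomials of exponent `≥ l`. -/
def ExpFactor.trunc (l : ℚ) (q : ExpFactor) : ExpFactor :=
  ⟨q.1.filter (fun k => l ≤ k), fun k hk => q.2 k (by
    rw [Finsupp.support_filter, Finset.mem_filter] at hk
    exact hk.1)⟩

/-- The truncation of a Stokes circle, `τ_l ⟨q⟩ = ⟨τ_l q⟩`. -/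
def StokesCircle.trunc (l : ℚ) : StokesCircle → StokesCircle :=
  Quotient.map (sa := galoisSetoid) (sb := galoisSetoid) (ExpFactor.trunc l) (by
    rintro q q' ⟨n, h⟩
    refine ⟨n, fun k => ?_⟩
    by_cases hk : l ≤ k
    · simp [ExpFactor.trunc, hk, h k]
    · simp [ExpFactor.trunc, hk])

/-- The set `E(I)` of exponents of a Stokes circle `I = ⟨q⟩`: those `k` for which `z ^ k` has a
nonzero coefficient in `q`. -/
def StokesCircle.exponents : StokesCircle → Finset ℚ :=
  Quotient.lift (s := galoisSetoid) (fun q => q.1.support) (by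
    rintro q q' ⟨n, h⟩
    ext k
    simp [h k, turn_ne_zero])

/-- The ramification order of an exponential factor: the least `r ≥ 1` such that `q` is a
polynomial in `z ^ (1 / r)`, that is, the lcm of the denominators of its exponents. -/
def ExpFactor.ram (q : ExpFactor) : ℕ := q.1.support.lcm Rat.den

/-- The ramification order of a Stokes circle. -/
def StokesCircle.ram (I : StokesCircle) : ℕ := I.exponents.lcm Rat.den

/-- The largest element of a finite set of positive exponents, `0` if the set is empty. -/
def slopeOf (S : Finset ℚ) : ℚ := if h : S.Nonempty then S.max' h else 0

/-! ### Loop and edge multiplicities -/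

/-- The integer `m` such that the positive exponent `k ∈ (1 / r) ℤ` is equal to `m / r`. -/
def numer (r : ℕ) (k : ℚ) : ℕ := (k * (r : ℚ)).num.natAbs

/-- `gcd (r, m_0, …, m_j)`, where `m_0 / r, …, m_j / r` are the elements of `S`;
it is `r` if `S` is empty. -/
def gcdOf (r : ℕ) (S : Finset ℚ) : ℕ := Nat.gcd r (S.gcd (numer r))

/-- For a set `S = {k_0 > … > k_t}` of exponents, with `k_j = m_j / r = m'_j / r'`, the sum over
`j = 0, …, t` of `m_j * (gcd (r', m'_0, …, m'_{j-1}) - gcd (r', m'_0, …, m'_j))`;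
the term of `j = 0` is `m_0 * (r' - gcd (r', m'_0))`. -/
def levelSum (r r' : ℕ) (S : Finset ℚ) : ℤ :=
  ∑ k ∈ S, (numer r k : ℤ) *
    ((gcdOf r' (S.filter (fun l => k < l)) : ℤ) - (gcdOf r' (S.filter (fun l => k ≤ l)) : ℤ))

/-- The loop multiplicity `B_{I,I}` of a Stokes circle. -/
def loopMult (I : StokesCircle) : ℤ :=
  levelSum I.ram I.ram I.exponents - (I.ram : ℤ) ^ 2 + 1

/-- The least positive element `l` of `(1 / lcm (r, r')) ℤ` such that `I` and `J` have the same
truncation `τ_l`. -/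
def commonIndex (I J : StokesCircle) : ℚ :=
  (sInf {n : ℕ | 0 < n ∧
      I.trunc ((n : ℚ) / (Nat.lcm I.ram J.ram : ℚ)) = J.trunc ((n : ℚ) / (Nat.lcm I.ram J.ram : ℚ))}
    : ℕ) / (Nat.lcm I.ram J.ram : ℚ)

/-- The common part `I_c = J_c` of `I` and `J` (written from `I`). -/
def commonPart (I J : StokesCircle) : StokesCircle := I.trunc (commonIndex I J)

/-- The slope of the different part `q_d = q - q_c` of `I = ⟨q⟩` with respect to `J`. -/
def diffSlope (I J : StokesCircle) : ℚ :=
  slopeOf (I.exponents.filter (fun k => k < commonIndex I J))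

/-- The edge multiplicity of two distinct Stokes circles `I`, `J` in the case
`diffSlope J I ≤ diffSlope I J`, so that the fission exponent is
`f = diffSlope I J = s_d / r` with `r = Ram I`; here `r' = Ram J`. -/
def edgeFormula (I J : StokesCircle) : ℤ :=
  levelSum I.ram J.ram (commonPart I J).exponents
    + (numer I.ram (diffSlope I J) : ℤ) * (gcdOf J.ram (commonPart I J).exponents : ℤ)
    - (I.ram : ℤ) * (J.ram : ℤ)

/-- The edge multiplicity `B_{I,J}` of two distinct Stokes circles. -/
def edgeMult (I J : StokesCircle) : ℤ :=
  if diffSlope J I ≤ diffSlope I J then edgeFormula I J else edgeFormula J I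

open Classical in
/-- The multiplicity `B_{I,J}` of any two Stokes circles. -/
def mult (I J : StokesCircle) : ℤ := if I = J then loopMult I else edgeMult I J

/-! ### Algebraic connections on the affine line and their irregular class at infinity -/

/-- An algebraic connection on the affine line with coordinate `z`: a vector bundle, i.e. a finitely
generated projective `ℂ[z]`-module `E`, with an additive map `nabla` (the covariant derivative along
`∂/∂z`) satisfying the Leibniz rule. -/
structure AlgConnection where
  E : Type
  [addCommGroup : AddCommGroup E]
  [module : Module ℂ[X] E]
  [finite : Module.Finite ℂ[X] E]
  [projective : Module.Projective ℂ[X] E]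
  nabla : E →+ E
  leibniz : ∀ (f : ℂ[X]) (v : E), nabla (f • v) = derivative f • v + f • nabla v

attribute [instance] AlgConnection.addCommGroup AlgConnection.module AlgConnection.finite
  AlgConnection.projective

/-- The derivation `z d/dz` on the field `ℂ((t))`, where `t ^ N = 1 / z`:
it maps `t ^ n` to `-(n / N) t ^ n`. -/
def euler (N : ℕ) (f : ℂ⸨X⸩) : ℂ⸨X⸩ where
  coeff n := -((n : ℂ) / (N : ℂ)) * f.coeff n
  isPWO_support' := f.isPWO_support.mono (by
    intro n hn
    rw [Function.mem_support] at hn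
    exact right_ne_zero_of_mul hn)

/-- A polynomial in `z` as an element of `ℂ((t))`, where `t ^ N = 1 / z`. -/
def polyAtInfinity (N : ℕ) (p : ℂ[X]) : ℂ⸨X⸩ :=
  Polynomial.aeval (HahnSeries.single (-(N : ℤ)) (1 : ℂ) : ℂ⸨X⸩) p

/-- An exponential factor whose ramification order divides `N`, as an element of `ℂ((t))`,
where `t ^ N = 1 / z`: the monomial `z ^ k` becomes `t ^ (-k N)`. -/
def ExpFactor.atInfinity (N : ℕ) (q : ExpFactor) : ℂ⸨X⸩ :=
  ∑ k ∈ q.1.support, HahnSeries.single (-(k * (N : ℚ)).num) (q.1 k)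

/-- The matrix `M` of a connection in a basis `b` of `E`: `∇ b_j = ∑ M_ij b_i`, so that
`∇ = d/dz + M` in the coordinates given by `b`. -/
def AlgConnection.matrix (C : AlgConnection) {n : ℕ} (b : Module.Basis (Fin n) ℂ[X] C.E) :
    Matrix (Fin n) (Fin n) ℂ[X] :=
  Matrix.of fun i j => b.repr (C.nabla (b j)) i

/-- The finite multiset `Θ = ∑ n_i I_i` of Stokes circles is the irregular class of the connection
at infinity. In a basis of `E`, and over `ℂ((t))` with `t ^ N = 1 / z` for a suitable `N ≥ 1`, the
horizontal sections have a formal fundamental matrix `g * z ^ L * exp (diag q)` (normal form of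
Turrittin and Levelt), with `g` invertible over `ℂ((t))`, `q` a family of exponential factors, and
`L` a constant matrix which commutes with `diag q`; and every exponential factor `p` occurs in
`q` as many times as the multiplicity of its Stokes circle `⟨p⟩` in `Θ`. -/
def AlgConnection.HasIrregularClass (C : AlgConnection) (Θ : StokesCircle →₀ ℕ) : Prop :=
  ∃ (n : ℕ) (b : Module.Basis (Fin n) ℂ[X] C.E) (N : ℕ) (g : Matrix (Fin n) (Fin n) ℂ⸨X⸩)
    (q : Fin n → ExpFactor) (L : Matrix (Fin n) (Fin n) ℂ),
    0 < N ∧ (∀ i, (q i).ram ∣ N) ∧ IsUnit g.det ∧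
    (∀ i j, q i ≠ q j → L i j = 0) ∧
    g.map (euler N)
        + g * (Matrix.diagonal (fun i => euler N ((q i).atInfinity N)) + L.map (fun c => (HahnSeries.C c : ℂ⸨X⸩)))
      = -((C.matrix b).map (fun f => polyAtInfinity N (Polynomial.X * f)) * g) ∧
    ∀ p : ExpFactor, Nat.card {i : Fin n // q i = p} = Θ (circ p)

/-! ### Nonabelian Hodge diagrams and graphs -/

/-- `Γ` is the core diagram `Γ_c(Θ)` of `Θ`: its vertices are identified with the distinct Stokes
circles of `Θ`, with the multiplicities `B_{I,I}`, `B_{I,J}` of these Stokes circles. -/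
def Diagram.IsCoreDiagram (Γ : Diagram) (Θ : StokesCircle →₀ ℕ) : Prop :=
  ∃ e : Γ.V ≃ {I : StokesCircle // I ∈ Θ.support},
    ∀ i j, Γ.B i j = mult (e i : StokesCircle) (e j : StokesCircle)

/-- `Γ` is the core diagram of an algebraic connection on the affine line. -/
def Diagram.IsNonabelianHodgeDiagram (Γ : Diagram) : Prop :=
  ∃ (C : AlgConnection) (Θ : StokesCircle →₀ ℕ), C.HasIrregularClass Θ ∧ Γ.IsCoreDiagram Θ

/-- A nonabelian Hodge graph is a nonabelian Hodge diagram that is a graph. -/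
def Diagram.IsNonabelianHodgeGraph (Γ : Diagram) : Prop :=
  Γ.IsNonabelianHodgeDiagram ∧ Γ.IsGraph

end NAH

end

namespace NAH

/-! ### The normalised average of the slopes of differences -/

/-! For distinct Stokes circles `I`, `J`, the number `B_{I,J} / (r r') + 1` is the mean slope of the
differences between conjugates. Indeed `gcd (r', m'_0, …, m'_j) / r'` is the proportion of turns
modulo `r'` that fix `z ^ k_0, …, z ^ k_j`, so the successive drops weight the slopes `k_j`, and the
turns fixing the whole common part contribute the fission exponent `f`
(`exists_mult_eq_averageSlope`). This mean depends only on the exponents of `I` above `f` and on `f`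
itself.

For a fixed circle the mean is monotone in `f` (`averageSlope_filter_mono`). Fission exponents are
ultrametric because agreement of truncations is transitive, hence so are the rescaled multiplicities
(`rescaled_mult_le_max`). In the triangle this would give `1 / (r r') ≤ 0` for two ramification
orders, whatever the class `Θ` is. -/

/-- The proportion `gcd (r, m_0, …, m_t) / r` attached to a set of exponents `m_j / r`. It does not
depend on `r`, and here `r` is the lcm of the denominators. -/
def fixedRatio (S : Finset ℚ) : ℚ :=
  (gcdOf (S.lcm Rat.den) S : ℚ) / (S.lcm Rat.den : ℕ)

/-- The average slope of the differences between the Galois conjugates of two exponential factors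
with fission exponent `f`, whose common part has the set of exponents `S`. -/
def averageSlope (S : Finset ℚ) (f : ℚ) : ℚ :=
  ∑ k ∈ S, k * (fixedRatio (S.filter (fun l => k < l)) - fixedRatio (S.filter (fun l => k ≤ l)))
    + f * fixedRatio S

lemma lcm_den_pos (S : Finset ℚ) : 0 < S.lcm Rat.den :=
  Nat.pos_of_ne_zero fun h => by
    obtain ⟨k, -, hk⟩ := Finset.lcm_eq_zero_iff.1 h
    exact k.den_nz hk

lemma numer_cast {r : ℕ} {k : ℚ} (hk : 0 ≤ k) (hr : k.den ∣ r) : (numer r k : ℚ) = k * r := by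
  obtain ⟨c, rfl⟩ := hr
  have h : k * ((k.den * c : ℕ) : ℚ) = ((k.num * c : ℤ) : ℚ) := by
    push_cast
    rw [← mul_assoc, Rat.mul_den_eq_num]
  have h0 : 0 ≤ k.num * (c : ℤ) := mul_nonneg (Rat.num_nonneg.2 hk) (by positivity)
  rw [numer, h, Rat.num_intCast]
  rw [← Int.cast_natCast, Int.natAbs_of_nonneg h0]

/-- Passing from `r` to `c * r` multiplies every numerator by `c`, and gcds are homogeneous. This is
what makes the ratio to `r` intrinsic to `S`. -/
lemma gcdOf_mul {r c : ℕ} {S : Finset ℚ} (hS : ∀ k ∈ S, 0 ≤ k ∧ k.den ∣ r) :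
    gcdOf (c * r) S = c * gcdOf r S := by
  have h : S.gcd (numer (c * r)) = S.gcd (fun k => c * numer r k) := by
    refine Finset.gcd_congr rfl fun k hk => ?_
    have h1 := numer_cast (hS k hk).1 (hS k hk).2
    have h2 := numer_cast (hS k hk).1 ((hS k hk).2.mul_left c)
    have : ((numer (c * r) k : ℕ) : ℚ) = ((c * numer r k : ℕ) : ℚ) := by
      rw [h2]; push_cast; rw [h1]; ring
    exact_mod_cast this
  rw [gcdOf, gcdOf, h, Finset.gcd_mul_left, normalize_eq, Nat.gcd_mul_left]

lemma gcdOf_div {r : ℕ} {S : Finset ℚ} (hr : 0 < r) (hS : ∀ k ∈ S, 0 ≤ k ∧ k.den ∣ r) :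
    (gcdOf r S : ℚ) / r = fixedRatio S := by
  obtain ⟨c, hc⟩ : S.lcm Rat.den ∣ r := Finset.lcm_dvd fun k hk => (hS k hk).2
  have hd := lcm_den_pos S
  have hc0 : (c : ℚ) ≠ 0 := by
    rintro h
    rw [Nat.cast_eq_zero] at h
    simp [hc, h] at hr
  rw [fixedRatio, hc, mul_comm,
    gcdOf_mul fun k hk => ⟨(hS k hk).1, Finset.dvd_lcm hk⟩]
  push_cast
  rw [mul_div_mul_left _ _ hc0]

lemma fixedRatio_nonneg (S : Finset ℚ) : 0 ≤ fixedRatio S := by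
  unfold fixedRatio; positivity

/-- The factor `1 / r` turns the numerators into exponents and `1 / r'` turns the gcds into
proportions, so both ramification orders disappear. -/
lemma levelSum_div {r r' : ℕ} {S : Finset ℚ} (hr : 0 < r) (hr' : 0 < r')
    (hS : ∀ k ∈ S, 0 ≤ k ∧ k.den ∣ r) (hS' : ∀ k ∈ S, 0 ≤ k ∧ k.den ∣ r') :
    (levelSum r r' S : ℚ) / (r * r') = ∑ k ∈ S, k *
      (fixedRatio (S.filter (fun l => k < l)) - fixedRatio (S.filter (fun l => k ≤ l))) := by
  rw [levelSum]
  push_cast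
  rw [Finset.sum_div]
  refine Finset.sum_congr rfl fun k hk => ?_
  rw [numer_cast (hS k hk).1 (hS k hk).2,
    ← gcdOf_div hr' fun l hl => hS' l (Finset.mem_of_mem_filter l hl),
    ← gcdOf_div hr' fun l hl => hS' l (Finset.mem_of_mem_filter l hl)]
  have : (r : ℚ) ≠ 0 := by positivity
  have : (r' : ℚ) ≠ 0 := by positivity
  field_simp

lemma averageSlope_mono_right {S : Finset ℚ} {f f' : ℚ} (h : f ≤ f') :
    averageSlope S f ≤ averageSlope S f' :=
  add_le_add_right (mul_le_mul_of_nonneg_right h (fixedRatio_nonneg S)) _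

/-- Adding a new lowest exponent `a` changes only the bottom of the sum: the right side minus the
left is `(a - f) * fixedRatio (insert a S)`. -/
lemma averageSlope_insert_le {S : Finset ℚ} {a f : ℚ} (ha : ∀ k ∈ S, a < k) (hf : f ≤ a) :
    averageSlope (insert a S) f ≤ averageSlope S a := by
  have haS : a ∉ S := fun h => lt_irrefl a (ha a h)
  have hlt : (insert a S).filter (fun l => a < l) = S := by
    rw [Finset.filter_insert, if_neg (lt_irrefl a), Finset.filter_true_of_mem ha]
  have hle : (insert a S).filter (fun l => a ≤ l) = insert a S := by
    rw [Finset.filter_insert, if_pos le_rfl, Finset.filter_true_of_mem fun k hk => (ha k hk).le]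
  have hsum : ∀ k ∈ S, k * (fixedRatio ((insert a S).filter (fun l => k < l))
        - fixedRatio ((insert a S).filter (fun l => k ≤ l)))
      = k * (fixedRatio (S.filter (fun l => k < l)) - fixedRatio (S.filter (fun l => k ≤ l))) := by
    intro k hk
    rw [Finset.filter_insert, Finset.filter_insert, if_neg (ha k hk).not_gt,
      if_neg (ha k hk).not_ge]
  rw [averageSlope, averageSlope, Finset.sum_insert haS, Finset.sum_congr rfl hsum, hlt, hle]
  nlinarith [mul_le_mul_of_nonneg_right hf (fixedRatio_nonneg (insert a S))]

lemma averageSlope_union_le {S : Finset ℚ} {f' : ℚ} (hS : ∀ k ∈ S, f' < k) (U : Finset ℚ) :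
    ∀ f ≤ f', (∀ k ∈ U, f < k ∧ k ≤ f') → averageSlope (U ∪ S) f ≤ averageSlope S f' := by
  -- Exponents are added in decreasing order. The bound `f` stays universally quantified, so that
  -- the induction hypothesis applies with the new lowest exponent `a` as fission exponent.
  induction U using Finset.induction_on_min with
  | empty =>
    intro f hf _
    rw [Finset.empty_union]
    exact averageSlope_mono_right hf
  | insert a U ha ih =>
    intro f hf hU
    have ha' := hU a (Finset.mem_insert_self a U)
    rw [Finset.insert_union]
    refine (averageSlope_insert_le (fun k hk => ?_) ha'.1.le).trans
      (ih a ha'.2 fun k hk => ⟨ha k hk, (hU k (Finset.mem_insert_of_mem hk)).2⟩)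
    rcases Finset.mem_union.1 hk with hk | hk
    · exact ha k hk
    · exact ha'.2.trans_lt (hS k hk)

/-- For a fixed exponential factor, the average slope increases with the fission exponent. -/
lemma averageSlope_filter_mono (E : Finset ℚ) {f f' : ℚ} (h : f ≤ f') :
    averageSlope (E.filter (fun k => f < k)) f ≤ averageSlope (E.filter (fun k => f' < k)) f' := by
  have hE : E.filter (fun k => f < k)
      = E.filter (fun k => f < k ∧ k ≤ f') ∪ E.filter (fun k => f' < k) := by
    ext k
    simp only [Finset.mem_union, Finset.mem_filter]
    constructor
    · rintro ⟨hk, hf⟩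
      rcases le_or_gt k f' with h' | h'
      · exact Or.inl ⟨hk, hf, h'⟩
      · exact Or.inr ⟨hk, h'⟩
    · rintro (⟨hk, hf, -⟩ | ⟨hk, hf⟩)
      · exact ⟨hk, hf⟩
      · exact ⟨hk, h.trans_lt hf⟩
  rw [hE]
  exact averageSlope_union_le (fun k hk => (Finset.mem_filter.1 hk).2) _ f h
    fun k hk => (Finset.mem_filter.1 hk).2

/-! ### Truncations and exponents of Stokes circles -/

namespace StokesCircle

lemma exponents_pos (I : StokesCircle) : ∀ k ∈ I.exponents, 0 < k := by
  induction I using Quotient.inductionOn with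
  | h q => exact q.2

lemma ram_pos (I : StokesCircle) : 0 < I.ram := lcm_den_pos _

lemma den_dvd_ram {I : StokesCircle} {k : ℚ} (hk : k ∈ I.exponents) : k.den ∣ I.ram :=
  Finset.dvd_lcm hk

lemma exponents_trunc (I : StokesCircle) (l : ℚ) :
    (I.trunc l).exponents = I.exponents.filter (fun k => l ≤ k) := by
  induction I using Quotient.inductionOn with
  | h q => exact Finsupp.support_filter _ _

lemma trunc_congr (I : StokesCircle) {l l' : ℚ}
    (h : ∀ k ∈ I.exponents, l ≤ k ↔ l' ≤ k) : I.trunc l = I.trunc l' := by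
  induction I using Quotient.inductionOn with
  | h q =>
    refine congrArg circ (Subtype.ext (Finsupp.ext fun k => ?_))
    change q.1.filter _ k = q.1.filter _ k
    by_cases hk : q.1 k = 0
    · simp [Finsupp.filter_apply, hk]
    · simp [Finsupp.filter_apply, h k (Finsupp.mem_support_iff.2 hk)]

lemma trunc_trunc (I : StokesCircle) {l l' : ℚ} (h : l ≤ l') :
    (I.trunc l).trunc l' = I.trunc l' := by
  induction I using Quotient.inductionOn with
  | h q =>
    refine congrArg circ (Subtype.ext (Finsupp.ext fun k => ?_))
    change (q.1.filter _).filter _ k = q.1.filter _ k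
    by_cases hk : l' ≤ k
    · simp [hk, h.trans hk]
    · simp [hk]

lemma trunc_eq_self (I : StokesCircle) {l : ℚ} (h : ∀ k ∈ I.exponents, l ≤ k) :
    I.trunc l = I := by
  induction I using Quotient.inductionOn with
  | h q =>
    refine congrArg circ (Subtype.ext (Finsupp.ext fun k => ?_))
    change q.1.filter _ k = q.1 k
    by_cases hk : q.1 k = 0
    · simp [Finsupp.filter_apply, hk]
    · simp [h k (Finsupp.mem_support_iff.2 hk)]

lemma trunc_eq_trunc_of_lt (I J : StokesCircle) {l : ℚ} (hI : ∀ k ∈ I.exponents, k < l)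
    (hJ : ∀ k ∈ J.exponents, k < l) : I.trunc l = J.trunc l := by
  induction I using Quotient.inductionOn with
  | h q =>
    induction J using Quotient.inductionOn with
    | h q' =>
      refine congrArg circ (Subtype.ext (Finsupp.ext fun k => ?_))
      change q.1.filter _ k = q'.1.filter _ k
      by_cases hl : l ≤ k
      · have h1 : q.1 k = 0 := by
          by_contra h
          exact (hI k (Finsupp.mem_support_iff.2 h)).not_ge hl
        have h2 : q'.1 k = 0 := by
          by_contra h
          exact (hJ k (Finsupp.mem_support_iff.2 h)).not_ge hl
        simp [Finsupp.filter_apply, h1, h2]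
      · simp [hl]

end StokesCircle

/-! ### Edge multiplicities and fission exponents -/

/-- `f` is the fission exponent of the Stokes circles `I` and `J`. -/
structure IsFissionExponent (I J : StokesCircle) (f : ℚ) : Prop where
  pos : 0 < f
  trunc_eq : ∀ l, f < l → I.trunc l = J.trunc l
  trunc_ne : I.trunc f ≠ J.trunc f

lemma IsFissionExponent.symm {I J : StokesCircle} {f : ℚ} (h : IsFissionExponent I J f) :
    IsFissionExponent J I f :=
  ⟨h.pos, fun l hl => (h.trunc_eq l hl).symm, h.trunc_ne.symm⟩

lemma IsFissionExponent.filter_exponents_eq {I J : StokesCircle} {f : ℚ}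
    (h : IsFissionExponent I J f) :
    I.exponents.filter (fun k => f < k) = J.exponents.filter (fun k => f < k) := by
  have key : ∀ k, f < k → (k ∈ I.exponents ↔ k ∈ J.exponents) := by
    intro k hk
    have := congrArg (fun K : StokesCircle => k ∈ K.exponents) (h.trunc_eq k hk)
    simpa [StokesCircle.exponents_trunc] using this
  ext k
  simp only [Finset.mem_filter]
  exact ⟨fun hk => ⟨(key k hk.2).1 hk.1, hk.2⟩, fun hk => ⟨(key k hk.2).2 hk.1, hk.2⟩⟩

lemma commonIndex_comm (I J : StokesCircle) : commonIndex I J = commonIndex J I := by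
  simp only [commonIndex, Nat.lcm_comm I.ram J.ram, eq_comm (a := I.trunc _)]

/-- A rational number whose denominator divides `L` cannot lie strictly between `(n - 1) / L`
and `n / L`. -/
lemma le_of_pred_lt_of_den_dvd {L n : ℕ} (hL : 0 < L) {k : ℚ} (hk : k.den ∣ L)
    (h : ((n : ℚ) - 1) / L < k) : (n : ℚ) / L ≤ k := by
  obtain ⟨c, hc⟩ := hk
  have hL' : (0 : ℚ) < L := by exact_mod_cast hL
  have hkL : k * L = ((k.num * c : ℤ) : ℚ) := by
    rw [hc]; push_cast
    rw [← mul_assoc, Rat.mul_den_eq_num]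
  rw [div_lt_iff₀ hL', hkL] at h
  rw [div_le_iff₀ hL', hkL]
  have h' : (n : ℤ) - 1 < k.num * c := by exact_mod_cast h
  have : (n : ℤ) ≤ k.num * c := by lia
  exact_mod_cast this

/-- Distinct Stokes circles have a fission exponent, and between it and the common index there are
no exponents. -/
lemma exists_fissionExponent {I J : StokesCircle} (hIJ : I ≠ J) :
    ∃ f, IsFissionExponent I J f ∧ f < commonIndex I J ∧
      (∀ k ∈ I.exponents, f < k → commonIndex I J ≤ k) ∧
      ∀ k ∈ J.exponents, f < k → commonIndex I J ≤ k := by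
  set L := Nat.lcm I.ram J.ram with hLdef
  have hL : 0 < L := Nat.lcm_pos I.ram_pos J.ram_pos
  have hL' : (0 : ℚ) < L := by exact_mod_cast hL
  set A : Set ℕ := {n : ℕ | 0 < n ∧ I.trunc ((n : ℚ) / L) = J.trunc ((n : ℚ) / L)} with hA
  have hne : A.Nonempty := by
    obtain ⟨M, hM⟩ := (I.exponents ∪ J.exponents).bddAbove
    obtain ⟨n, hn⟩ := exists_nat_gt (M * L)
    have hb : ∀ k ∈ I.exponents ∪ J.exponents, k < ((n + 1 : ℕ) : ℚ) / L := by
      intro k hk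
      rw [lt_div_iff₀ hL']
      have := mul_le_mul_of_nonneg_right (hM hk) hL'.le
      push_cast
      linarith
    exact ⟨n + 1, n.succ_pos, StokesCircle.trunc_eq_trunc_of_lt I J
      (fun k hk => hb k (Finset.mem_union_left _ hk))
      (fun k hk => hb k (Finset.mem_union_right _ hk))⟩
  set n := sInf A with hn
  have hc : commonIndex I J = (n : ℚ) / L := rfl
  obtain ⟨hn0, hn1⟩ : n ∈ A := Nat.sInf_mem hne
  have hdI : ∀ k ∈ I.exponents, k.den ∣ L := fun k hk =>
    (StokesCircle.den_dvd_ram hk).trans (Nat.dvd_lcm_left _ _)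
  have hdJ : ∀ k ∈ J.exponents, k.den ∣ L := fun k hk =>
    (StokesCircle.den_dvd_ram hk).trans (Nat.dvd_lcm_right _ _)
  have hgI : ∀ k ∈ I.exponents, ((n : ℚ) - 1) / L < k → (n : ℚ) / L ≤ k := fun k hk h =>
    le_of_pred_lt_of_den_dvd hL (hdI k hk) h
  have hgJ : ∀ k ∈ J.exponents, ((n : ℚ) - 1) / L < k → (n : ℚ) / L ≤ k := fun k hk h =>
    le_of_pred_lt_of_den_dvd hL (hdJ k hk) h
  -- If `n = 1`, the truncation at `1 / L` already keeps every exponent, so the two circles would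
  -- coincide.
  have hn2 : 1 < n := by
    by_contra h
    have h1 : n = 1 := by lia
    rw [h1] at hgI hgJ hn1
    simp only [Nat.cast_one, sub_self, zero_div] at hgI hgJ hn1
    rw [I.trunc_eq_self fun k hk => hgI k hk (I.exponents_pos k hk),
      J.trunc_eq_self fun k hk => hgJ k hk (J.exponents_pos k hk)] at hn1
    exact hIJ hn1
  have hlt : ((n : ℚ) - 1) / L < (n : ℚ) / L :=
    div_lt_div_of_pos_right (by linarith) hL'
  -- The fission exponent is the grid point just below the common index.
  refine ⟨((n : ℚ) - 1) / L, ⟨?_, ?_, ?_⟩, hlt, hgI, hgJ⟩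
  · have : (1 : ℚ) < n := by exact_mod_cast hn2
    exact div_pos (by linarith) hL'
  · intro l hl
    rcases le_total ((n : ℚ) / L) l with h | h
    · rw [← I.trunc_trunc h, ← J.trunc_trunc h, hn1]
    · rw [I.trunc_congr fun k hk => ⟨fun h' => hgI k hk (hl.trans_le h'), h.trans⟩, hn1,
        J.trunc_congr fun k hk => ⟨fun h' => hgJ k hk (hl.trans_le h'), h.trans⟩]
  · intro h
    have hmem : n - 1 ∈ A := by
      refine ⟨by lia, ?_⟩
      rw [Nat.cast_sub hn0.nat_succ_le, Nat.cast_one]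
      exact h
    have := Nat.sInf_le hmem
    lia

lemma slopeOf_le {S : Finset ℚ} {f : ℚ} (hf : 0 ≤ f) (h : ∀ k ∈ S, k ≤ f) : slopeOf S ≤ f := by
  unfold slopeOf
  split_ifs with hS
  · exact Finset.max'_le _ _ _ h
  · exact hf

lemma le_slopeOf {S : Finset ℚ} {k : ℚ} (hk : k ∈ S) : k ≤ slopeOf S := by
  rw [slopeOf, dif_pos ⟨k, hk⟩]
  exact Finset.le_max' _ _ hk

lemma slopeOf_mem {S : Finset ℚ} (h : 0 < slopeOf S) : slopeOf S ∈ S := by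
  unfold slopeOf at h ⊢
  split_ifs at h ⊢ with hS
  · exact Finset.max'_mem _ _
  · exact absurd h (lt_irrefl _)

/-- The gap below the common index identifies the common part with the exponents above `f`, and the
circle whose different part has the larger slope has that slope equal to `f`. -/
lemma edgeFormula_div {I J : StokesCircle} {f : ℚ} (hf : IsFissionExponent I J f)
    (hlt : f < commonIndex I J) (hI : ∀ k ∈ I.exponents, f < k → commonIndex I J ≤ k)
    (hJ : ∀ k ∈ J.exponents, f < k → commonIndex I J ≤ k)
    (hle : diffSlope J I ≤ diffSlope I J) :
    (edgeFormula I J : ℚ) / (I.ram * J.ram) + 1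
      = averageSlope (I.exponents.filter (fun k => f < k)) f := by
  have hle_of : ∀ K : StokesCircle, (∀ k ∈ K.exponents, f < k → commonIndex I J ≤ k) →
      ∀ k ∈ K.exponents.filter (fun k => k < commonIndex I J), k ≤ f := by
    intro K hK k hk
    rw [Finset.mem_filter] at hk
    by_contra h
    exact (hK k hk.1 (not_le.1 h)).not_gt hk.2
  -- If only `J` had the exponent `f`, its different part would have the larger slope, against
  -- `hle`; if neither had it, the truncations at `f` would still agree.
  have hfI : f ∈ I.exponents := by
    by_contra h
    have hfJ : f ∉ J.exponents := by
      intro hfJ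
      have h1 : f ≤ diffSlope J I := by
        refine le_slopeOf (Finset.mem_filter.2 ⟨hfJ, ?_⟩)
        rwa [commonIndex_comm]
      have h2 : diffSlope I J ≤ f := slopeOf_le hf.pos.le (hle_of I hI)
      have h3 : diffSlope I J = f := le_antisymm h2 (h1.trans hle)
      have h4 : diffSlope I J ∈ I.exponents.filter (fun k => k < commonIndex I J) :=
        -- Positivity excludes the default value `0` of `slopeOf` on the empty set.
        slopeOf_mem (hf.pos.trans_eq h3.symm)
      rw [h3] at h4
      exact h (Finset.mem_of_mem_filter _ h4)
    refine hf.trunc_ne ?_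
    have aux : ∀ K : StokesCircle, (∀ k ∈ K.exponents, f < k → commonIndex I J ≤ k) →
        f ∉ K.exponents → K.trunc f = K.trunc (commonIndex I J) := fun K hK hfK =>
      K.trunc_congr fun k hk =>
        ⟨fun h' => hK k hk (lt_of_le_of_ne h' fun e => hfK (e ▸ hk)), fun h' => hlt.le.trans h'⟩
    rw [aux I hI h, aux J hJ hfJ, hf.trunc_eq _ hlt]
  have hdiff : diffSlope I J = f :=
    le_antisymm (slopeOf_le hf.pos.le (hle_of I hI))
      (le_slopeOf (Finset.mem_filter.2 ⟨hfI, hlt⟩))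
  have hS : (commonPart I J).exponents = I.exponents.filter (fun k => f < k) := by
    rw [commonPart, StokesCircle.exponents_trunc]
    exact Finset.filter_congr fun k hk => ⟨hlt.trans_le, hI k hk⟩
  have hSI : ∀ k ∈ I.exponents.filter (fun k => f < k), 0 ≤ k ∧ k.den ∣ I.ram := fun k hk =>
    have hk' := Finset.mem_of_mem_filter k hk
    ⟨(I.exponents_pos k hk').le, StokesCircle.den_dvd_ram hk'⟩
  have hSJ : ∀ k ∈ I.exponents.filter (fun k => f < k), 0 ≤ k ∧ k.den ∣ J.ram := fun k hk =>
    have hk' := Finset.mem_of_mem_filter k (hf.filter_exponents_eq ▸ hk)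
    ⟨(J.exponents_pos k hk').le, StokesCircle.den_dvd_ram hk'⟩
  have hrI : (I.ram : ℚ) ≠ 0 := by exact_mod_cast I.ram_pos.ne'
  have hrJ : (J.ram : ℚ) ≠ 0 := by exact_mod_cast J.ram_pos.ne'
  rw [averageSlope, ← levelSum_div I.ram_pos J.ram_pos hSI hSJ, ← gcdOf_div J.ram_pos hSJ,
    edgeFormula, hS, hdiff]
  push_cast
  rw [numer_cast hf.pos.le (StokesCircle.den_dvd_ram hfI)]
  field_simp
  ring

/-- The rescaled edge multiplicity of two distinct Stokes circles, in terms of their fission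
exponent. -/
lemma exists_mult_eq_averageSlope {I J : StokesCircle} (hIJ : I ≠ J) :
    ∃ f, IsFissionExponent I J f ∧ (mult I J : ℚ) / (I.ram * J.ram) + 1
      = averageSlope (I.exponents.filter (fun k => f < k)) f := by
  obtain ⟨f, hf, hlt, hI, hJ⟩ := exists_fissionExponent hIJ
  refine ⟨f, hf, ?_⟩
  rw [mult, if_neg hIJ, edgeMult]
  split_ifs with hle
  · exact edgeFormula_div hf hlt hI hJ hle
  · rw [mul_comm, hf.filter_exponents_eq]
    rw [commonIndex_comm] at hlt hI hJ
    exact edgeFormula_div hf.symm hlt hJ hI (not_le.1 hle).le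

/-- The ultrametric inequality for the rescaled edge multiplicities of Stokes circles. -/
theorem rescaled_mult_le_max {I J K : StokesCircle} (hIJ : I ≠ J) (hIK : I ≠ K) (hJK : J ≠ K) :
    (mult J K : ℚ) / (J.ram * K.ram)
      ≤ max ((mult I J : ℚ) / (I.ram * J.ram)) ((mult I K : ℚ) / (I.ram * K.ram)) := by
  obtain ⟨f, hf, h1⟩ := exists_mult_eq_averageSlope hIJ
  obtain ⟨g, hg, h2⟩ := exists_mult_eq_averageSlope hIK
  obtain ⟨d, hd, h3⟩ := exists_mult_eq_averageSlope hJK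
  -- When `d ≤ f` or `d ≤ g`, the two averages are rewritten over the exponents of the circle shared
  -- by the two pairs, where monotonicity applies.
  rcases le_or_gt d f with h | hfd
  · rw [hf.filter_exponents_eq] at h1
    have := averageSlope_filter_mono J.exponents h
    exact le_max_of_le_left (by linarith)
  rcases le_or_gt d g with h | hgd
  · rw [hg.filter_exponents_eq] at h2
    rw [hd.filter_exponents_eq] at h3
    have := averageSlope_filter_mono K.exponents h
    exact le_max_of_le_right (by linarith)
  -- If `d` exceeded both `f` and `g`, then `J` and `K` would agree at `d` through `I`.
  exact absurd ((hf.trunc_eq d hfd).symm.trans (hg.trunc_eq d hgd)) hd.trunc_ne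

/-! ### The triangle -/

lemma triangle_isGraph : triangle.IsGraph := by
  constructor
  · intro i j
    have h : ∀ i j : Fin 3, 0 ≤ (!![0, 0, 0; 0, 0, 1; 0, 1, 0] : Matrix (Fin 3) (Fin 3) ℤ) i j := by
      intro i j
      fin_cases i <;> fin_cases j <;> simp
    exact h i j
  · intro i
    have : ∀ i : Fin 3, (!![0, 0, 0; 0, 0, 1; 0, 1, 0] : Matrix (Fin 3) (Fin 3) ℤ) i i = 0 := by
      decide
    exact this i

lemma triangle_not_isCoreDiagram (Θ : StokesCircle →₀ ℕ) : ¬ triangle.IsCoreDiagram Θ := by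
  rintro ⟨e, he⟩
  have hne : ∀ i j : Fin 3, i ≠ j → (e i : StokesCircle) ≠ e j := fun i j hij h =>
    hij (e.injective (Subtype.ext h))
  have h01 : mult (e (0 : Fin 3)) (e (1 : Fin 3)) = 0 := (he (0 : Fin 3) (1 : Fin 3)).symm
  have h02 : mult (e (0 : Fin 3)) (e (2 : Fin 3)) = 0 := (he (0 : Fin 3) (2 : Fin 3)).symm
  have h12 : mult (e (1 : Fin 3)) (e (2 : Fin 3)) = 1 := (he (1 : Fin 3) (2 : Fin 3)).symm
  have h := rescaled_mult_le_max (hne 0 1 (by decide)) (hne 0 2 (by decide)) (hne 1 2 (by decide))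
  rw [h01, h02, h12] at h
  simp only [Int.cast_zero, Int.cast_one, zero_div, max_self] at h
  have h1 : (0 : ℚ) < (e (1 : Fin 3) : StokesCircle).ram := by
    exact_mod_cast StokesCircle.ram_pos _
  have h2 : (0 : ℚ) < (e (2 : Fin 3) : StokesCircle).ram := by
    exact_mod_cast StokesCircle.ram_pos _
  exact absurd h (not_le.2 (by positivity))

lemma triangle_not_isNonabelianHodgeDiagram : ¬ triangle.IsNonabelianHodgeDiagram :=
  fun ⟨_, Θ, _, h⟩ => triangle_not_isCoreDiagram Θ h

lemma triangle_not_rescaledUltrametric (r : triangle.V → ℕ) (hr : ∀ i, 1 ≤ r i) :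
    ¬ triangle.RescaledUltrametric r := by
  intro h
  have h1 : (0 : ℚ) < r (1 : Fin 3) := by exact_mod_cast hr (1 : Fin 3)
  have h2 : (0 : ℚ) < r (2 : Fin 3) := by exact_mod_cast hr (2 : Fin 3)
  have n01 : (0 : Fin 3) ≠ 1 := by decide
  have n02 : (0 : Fin 3) ≠ 2 := by decide
  have n12 : (1 : Fin 3) ≠ 2 := by decide
  have e01 : triangle.rescaled r (0 : Fin 3) (1 : Fin 3) = 0 := by
    refine (if_neg n01).trans ?_
    rw [show triangle.B (0 : Fin 3) (1 : Fin 3) = 0 from rfl, Int.cast_zero, zero_div]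
  have e02 : triangle.rescaled r (0 : Fin 3) (2 : Fin 3) = 0 := by
    refine (if_neg n02).trans ?_
    rw [show triangle.B (0 : Fin 3) (2 : Fin 3) = 0 from rfl, Int.cast_zero, zero_div]
  have e12 : 0 < triangle.rescaled r (1 : Fin 3) (2 : Fin 3) := by
    refine lt_of_lt_of_eq ?_ (if_neg n12).symm
    rw [show triangle.B (1 : Fin 3) (2 : Fin 3) = 1 from rfl, Int.cast_one]
    positivity
  have := h (0 : Fin 3) (1 : Fin 3) (2 : Fin 3) n01 n02 n12
    (e01.trans e02.symm).le (e02.trans_lt e12).le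
  rw [e02] at this
  exact e12.ne this

end NAH

theorem proposition4p4 :
    (∃ Γ : NAH.Diagram, Γ.IsGraph ∧ ¬ Γ.IsNonabelianHodgeGraph) ∧
    (∃ Γ : NAH.Diagram, ¬ Γ.IsNonabelianHodgeDiagram) ∧
    NAH.triangle.IsGraph ∧ ¬ NAH.triangle.IsNonabelianHodgeGraph ∧
    ∀ r : NAH.triangle.V → ℕ, (∀ i, 1 ≤ r i) → ¬ NAH.triangle.RescaledUltrametric r := by
  have h : ¬ NAH.triangle.IsNonabelianHodgeGraph := fun h =>
    NAH.triangle_not_isNonabelianHodgeDiagram h.1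
  exact ⟨⟨_, NAH.triangle_isGraph, h⟩, ⟨_, NAH.triangle_not_isNonabelianHodgeDiagram⟩,
    NAH.triangle_isGraph, h, NAH.triangle_not_rescaledUltrametric⟩
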